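/- Let $n\ge 0$ and $\bar q\ge 1$ be integers and $\mathcal Q=\{1,\dots,\bar q\}$. For each $q\in\mathcal Q$ let $d_q:\mathbb R^n\to\mathbb R^n$, let $b_q:\mathbb R^n\to\mathbb R^{n\times n}$ be such that $b_q(x)$ is invertible for all $x$, and let $A_q\in\mathbb R^{n\times n}$ be Hurwitz (all complex eigenvalues have negative real part). Consider the switched plant $\dot x=d_q(x)+b_q(x)u_q$ with the feedback $u_q(x,\mu)=b_q(x)^{-1}(\mu A_qx-d_q(x))$. Given $\tau_d>0$, $N_0\ge 1$, $T>0$ and real $k\ge1$, consider the closed-loop hybrid dynamical system with state $z=(x,\tau,q,\mu)\in\mathbb R^{n+3}$: flows, for $z\in \mathbb R^n\times[0,N_0]\times\mathcal Q\times[1,\infty)$: $$\dot x=d_q(x)+b_q(x)u_q(x,\mu),\quad \dot\tau\in\Big[0,\frac{\mu}{\tau_d}\Big],\quad \dot q=0,\quad \dot\mu=\frac kT\mu^{1+1/k};$$ jumps, for $z\in \mathbb R^n\times[1,N_0]\times\mathcal Q\times[1,\infty)$: $$x^+=x,\quad \tau^+=\tau-1,\quad q^+\in\mathcal Q\setminus\{q\},\quad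 \mu^+=\mu.$$ Let $\mathcal A_1=\{0\}\times[0,N_0]\times\mathcal Q\subset\mathbb R^{n+2}$ and $\mathcal A=\mathcal A_1\times\mathbb R_{\ge1}$. Then there exists $\tau_d>0$ such that for all $N_0\ge1$, $T>0$ and $k\ge1$ the set $\mathcal A$ is prescribed-time stable via flows for this system. That is, $\mathcal A_1$ is compact and there is a function $\beta:\mathbb R_{\ge0}^3\to\mathbb R_{\ge0}$ of class $\mathcal{KLL}$ such that every solution $z$ (a locally absolutely continuous hybrid arc, not necessarily maximal, on a hybrid time domain $\mathrm{dom}(z)\subset\mathbb R_{\ge0}\times\mathbb Z_{\ge0}$) satisfies $$|z(t,j)|_{\mathcal A}\le\beta\big(|z(0,0)|_{\mathcal A},\,\mathcal T_k(t),\,j\big)\qquad\text{for all }(t,j)\in\mathrm{dom}(z).$$ Here $|\cdot|_{\mathcal A}$ is the Euclidean distance to $\mathcal A$. With $\mu_0=\mu(0,0)$ and $\Upsilon=T\mu_0^{-1/k}$, the time dilation is $\mathcal T_k(t)=\omega_k(\mu_k(t),\mu_0)$ for $t\in[0,\Upsilon)$, where $\mu_k(t)=T^k/(\Upsilon-t)^k$,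 $\omega_1(b,a)=T\ln(b/a)$, and $\omega_k(b,a)=\frac{T}{k-1}\big(b^{(k-1)/k}-a^{(k-1)/k}\big)$ for $k>1$. A function $\beta$ is of class $\mathcal{KLL}$ if $\beta(\cdot,s,\cdot)$ and $\beta(\cdot,\cdot,s)$ are of class $\mathcal{KL}$ for every $s\ge0$. A function $\alpha:\mathbb R_{\ge0}^2\to\mathbb R_{\ge0}$ is of class $\mathcal{KL}$ if it is nondecreasing in its first argument, nonincreasing in its second, $\lim_{r\to0^+}\alpha(r,s)=0$ for each $s$, and $\lim_{s\to\infty}\alpha(r,s)=0$ for each $r$. -/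

import Mathlib

open Set Filter Topology MeasureTheory
open scoped Pointwise

/-! ### Hybrid time domains, hybrid systems and their solutions -/

/-- Compact hybrid time domain: `⋃_{j < J} [t_j, t_{j+1}] × {j}` with `0 = t_0 ≤ t_1 ≤ … ≤ t_J`. -/
def IsCompactHybridTimeDomain (E : Set (ℝ × ℕ)) : Prop :=
  ∃ (J : ℕ) (t : ℕ → ℝ), t 0 = 0 ∧ (∀ j < J, t j ≤ t (j + 1)) ∧
    E = {p | p.2 < J ∧ t p.2 ≤ p.1 ∧ p.1 ≤ t (p.2 + 1)}

/-- Hybrid time domain: every truncation `E ∩ ([0,T] × {0,…,J})` with `(T,J) ∈ E` is compact. -/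
def IsHybridTimeDomain (E : Set (ℝ × ℕ)) : Prop :=
  (∀ p ∈ E, 0 ≤ p.1) ∧
    ∀ p ∈ E, IsCompactHybridTimeDomain (E ∩ {r | 0 ≤ r.1 ∧ r.1 ≤ p.1 ∧ r.2 ≤ p.2})

/-- The interval `I_j = {t : (t,j) ∈ E}`. -/
def flowInterval (E : Set (ℝ × ℕ)) (j : ℕ) : Set ℝ := {t | (t, j) ∈ E}

/-- Data of an (input-free) hybrid dynamical system `ż ∈ F(z), z ∈ C`; `z⁺ ∈ G(z), z ∈ D`. -/
structure HybridSystem (Z : Type*) where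
  /-- flow set -/
  C : Set Z
  /-- flow map -/
  F : Z → Set Z
  /-- jump set -/
  D : Set Z
  /-- jump map -/
  G : Z → Set Z

/-- `z`, restricted to the hybrid time domain `E`, is a solution (not necessarily maximal) of the
hybrid system `H`. The values of `z` outside `E` are irrelevant. -/
structure IsHybridSolution {Z : Type*} [NormedAddCommGroup Z] [NormedSpace ℝ Z]
    (H : HybridSystem Z) (E : Set (ℝ × ℕ)) (z : ℝ → ℕ → Z) : Prop where
  domain : IsHybridTimeDomain E
  zero_mem : (0, 0) ∈ E
  initial : z 0 0 ∈ H.C ∪ H.D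
  /-- `z(·, j)` is locally absolutely continuous on `I_j`. -/
  absCont : ∀ j, ∀ a b : ℝ, a ≤ b → Icc a b ⊆ flowInterval E j →
    AbsolutelyContinuousOnInterval (fun t => z t j) a b
  flow : ∀ j, (interior (flowInterval E j)).Nonempty →
    ∀ᵐ t ∂volume, t ∈ flowInterval E j →
      z t j ∈ H.C ∧ ∃ v ∈ H.F (z t j), HasDerivWithinAt (fun s => z s j) v (flowInterval E j) t
  jump : ∀ t j, (t, j) ∈ E → (t, j + 1) ∈ E → z t j ∈ H.D ∧ z t (j + 1) ∈ H.G (z t j)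

/-! ### Comparison functions -/

/-- Class `𝒦ℒ`, for functions on nonnegative reals (values at negative reals are irrelevant). -/
structure IsKL (β : ℝ → ℝ → ℝ) : Prop where
  nonneg : ∀ r s, 0 ≤ r → 0 ≤ s → 0 ≤ β r s
  mono : ∀ s, 0 ≤ s → MonotoneOn (fun r => β r s) (Ici 0)
  anti : ∀ r, 0 ≤ r → AntitoneOn (fun s => β r s) (Ici 0)
  tendsto_left : ∀ s, 0 ≤ s → Tendsto (fun r => β r s) (𝓝[>] 0) (𝓝 0)
  tendsto_right : ∀ r, 0 ≤ r → Tendsto (fun s => β r s) atTop (𝓝 0)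

/-- Class `𝒦ℒℒ`: for every `s ≥ 0`, both `β(·, s, ·)` and `β(·, ·, s)` are of class `𝒦ℒ`. -/
def IsKLL (β : ℝ → ℝ → ℝ → ℝ) : Prop :=
  ∀ s, 0 ≤ s → IsKL (fun r l => β r s l) ∧ IsKL (fun r l => β r l s)

/-! ### The blow-up gain and the time dilation it induces -/

noncomputable section

/-- The prescribed time `Υ_{T,k} = T μ₀^{-1/k}`. -/
def prescribedTime (T k μ₀ : ℝ) : ℝ := T * μ₀ ^ (-(1 / k))

/-- The blow-up gain `μ_k(t) = T^k / (Υ_{T,k} - t)^k`, meaningful for `t < Υ_{T,k}`. -/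
def blowUpGain (T k μ₀ t : ℝ) : ℝ := T ^ k / (prescribedTime T k μ₀ - t) ^ k

/-- `ω_k(b,a)`; the value for `k = 1` is the limit as `k → 1⁺`, see `tendsto_omegaFun`. -/
def omegaFun (T k b a : ℝ) : ℝ :=
  if k = 1 then T * (Real.log b - Real.log a)
  else T / k * ((b ^ ((k - 1) / k) - 1) / ((k - 1) / k) - (a ^ ((k - 1) / k) - 1) / ((k - 1) / k))

theorem tendsto_omegaFun (T : ℝ) {a b : ℝ} (ha : 1 ≤ a) (hb : 1 ≤ b) :
    Tendsto (fun k => omegaFun T k b a) (𝓝[>] 1) (𝓝 (omegaFun T 1 b a)) := by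
  have hk : Tendsto (fun k : ℝ => k) (𝓝[>] 1) (𝓝 1) := tendsto_id.mono_left nhdsWithin_le_nhds
  have hρ : Tendsto (fun k : ℝ => (k - 1) / k) (𝓝[>] 1) (𝓝[>] 0) := by
    refine tendsto_nhdsWithin_iff.2 ⟨?_, ?_⟩
    · have h0 : Tendsto (fun k : ℝ => (k - 1) / k) (𝓝[>] 1) (𝓝 ((1 - 1) / 1)) :=
        (hk.sub_const 1).div hk one_ne_zero
      simpa only [sub_self, zero_div] using h0
    · filter_upwards [self_mem_nhdsWithin] with k h1
      exact div_pos (sub_pos.2 (mem_Ioi.1 h1)) (zero_lt_one.trans (mem_Ioi.1 h1))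
  have hB := (tendsto_rpow_sub_one_log (by linarith : 0 < b)).comp hρ
  have hA := (tendsto_rpow_sub_one_log (by linarith : 0 < a)).comp hρ
  have hT : Tendsto (fun k : ℝ => T / k) (𝓝[>] 1) (𝓝 (T / 1)) :=
    tendsto_const_nhds.div hk one_ne_zero
  have h := hT.mul (hB.sub hA)
  rw [div_one] at h
  have h1 : omegaFun T 1 b a = T * (Real.log b - Real.log a) := by simp [omegaFun]
  rw [h1]
  refine h.congr' ?_
  filter_upwards [self_mem_nhdsWithin] with k hk1
  have hk1 : (1 : ℝ) < k := hk1
  simp only [omegaFun, if_neg hk1.ne', Function.comp_apply]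
  ring

/-- The time dilation `𝒯_k(t) = ω_k(μ_k(t), μ_k(0))`, `t ∈ [0, Υ_{T,k})`. -/
def timeDilation (T k μ₀ t : ℝ) : ℝ :=
  omegaFun T k (blowUpGain T k μ₀ t) (blowUpGain T k μ₀ 0)

/-! ### Hybrid systems driven by the blow-up gain -/

section BlowUp

variable {ι : Type*} [Fintype ι]

/-- The component `ψ ∈ ℝ^ι` of the state `z = (ψ, μ) ∈ ℝ^ι × ℝ`. -/
def psiPart (z : EuclideanSpace ℝ (ι ⊕ Unit)) : EuclideanSpace ℝ ι :=
  WithLp.toLp 2 fun i => z (Sum.inl i)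

/-- The component `μ ∈ ℝ` of the state `z = (ψ, μ) ∈ ℝ^ι × ℝ`. -/
def muPart (z : EuclideanSpace ℝ (ι ⊕ Unit)) : ℝ := z (Sum.inr ())

/-- The hybrid system with state `z = (ψ, μ)` and
`ψ̇ ∈ μ · FP(ψ, μ)`, `μ̇ = (k/T) μ^{1+1/k}` on `C = PC × [1,∞)`;
`ψ⁺ ∈ GP(ψ)`, `μ⁺ = μ` on `D = PD × [1,∞)`. -/
def blowUpSystem (T k : ℝ) (PC PD : Set (EuclideanSpace ℝ ι))
    (FP : EuclideanSpace ℝ ι → ℝ → Set (EuclideanSpace ℝ ι))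
    (GP : EuclideanSpace ℝ ι → Set (EuclideanSpace ℝ ι)) :
    HybridSystem (EuclideanSpace ℝ (ι ⊕ Unit)) where
  C := {z | psiPart z ∈ PC ∧ 1 ≤ muPart z}
  F z := {v | psiPart v ∈ muPart z • FP (psiPart z) (muPart z) ∧
    muPart v = k / T * muPart z ^ (1 + 1 / k)}
  D := {z | psiPart z ∈ PD ∧ 1 ≤ muPart z}
  G z := {w | psiPart w ∈ GP (psiPart z) ∧ muPart w = muPart z}

/-- Prescribed-time stability via flows of `𝒜 = A₁ × [1,∞)`, with `A₁` compact, for a hybrid system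
with state `z = (ψ, μ)`: every solution satisfies
`|z(t,j)|_𝒜 ≤ β(|z(0,0)|_𝒜, 𝒯_k(t), j)`, where `𝒯_k` is built from `μ₀ = μ(0,0)`. -/
def IsPrescribedTimeStableViaFlows (T k : ℝ) (H : HybridSystem (EuclideanSpace ℝ (ι ⊕ Unit)))
    (A₁ : Set (EuclideanSpace ℝ ι)) : Prop :=
  IsCompact A₁ ∧ ∃ β : ℝ → ℝ → ℝ → ℝ, IsKLL β ∧
    ∀ (E : Set (ℝ × ℕ)) (z : ℝ → ℕ → EuclideanSpace ℝ (ι ⊕ Unit)), IsHybridSolution H E z →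
      ∀ t j, (t, j) ∈ E →
        Metric.infDist (z t j) {y | psiPart y ∈ A₁ ∧ 1 ≤ muPart y} ≤
          β (Metric.infDist (z 0 0) {y | psiPart y ∈ A₁ ∧ 1 ≤ muPart y})
            (timeDilation T k (muPart (z 0 0)) t) j

end BlowUp

/-! ### The switched plant in closed loop -/

/-- The state space `ℝⁿ × ℝ × ℝ` of `ψ = (x, τ, q)`. -/
abbrev SwitchState (n : ℕ) := EuclideanSpace ℝ (Fin n ⊕ Fin 2)

/-- The component `x ∈ ℝⁿ` of `ψ = (x, τ, q)`. -/
def xPart {n : ℕ} (ψ : SwitchState n) : EuclideanSpace ℝ (Fin n) :=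
  WithLp.toLp 2 fun i => ψ (Sum.inl i)

/-- The component `τ` of `ψ = (x, τ, q)`. -/
def tauPart {n : ℕ} (ψ : SwitchState n) : ℝ := ψ (Sum.inr 0)

/-- The component `q` of `ψ = (x, τ, q)`. -/
def qPart {n : ℕ} (ψ : SwitchState n) : ℝ := ψ (Sum.inr 1)

/-- The mode set `{1, …, Q}` as a subset of `ℝ`; the mode `i + 1` is indexed by `i : Fin Q`. -/
def modeSet (Q : ℕ) : Set ℝ := {q | ∃ i : Fin Q, q = (i : ℝ) + 1}

/-- `ℝⁿ × [a, b] × {1, …, Q}`. -/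
def switchSet (n Q : ℕ) (a b : ℝ) : Set (SwitchState n) :=
  {ψ | tauPart ψ ∈ Icc a b ∧ qPart ψ ∈ modeSet Q}

/-- `{0} × [0, N₀] × {1, …, Q}`. -/
def targetSet (n Q : ℕ) (N₀ : ℝ) : Set (SwitchState n) :=
  {ψ | xPart ψ = 0 ∧ tauPart ψ ∈ Icc 0 N₀ ∧ qPart ψ ∈ modeSet Q}

/-- A real square matrix is Hurwitz if all its complex eigenvalues have negative real part. -/
def IsHurwitz {n : ℕ} (A : Matrix (Fin n) (Fin n) ℝ) : Prop :=
  ∀ l ∈ spectrum ℂ (A.map (algebraMap ℝ ℂ)), l.re < 0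

/-- The feedback `u(x, μ) = b(x)⁻¹ (μ A x - d(x))`. -/
def regulationFeedback {n : ℕ} (d : EuclideanSpace ℝ (Fin n) → EuclideanSpace ℝ (Fin n))
    (b : EuclideanSpace ℝ (Fin n) → Matrix (Fin n) (Fin n) ℝ) (A : Matrix (Fin n) (Fin n) ℝ)
    (x : EuclideanSpace ℝ (Fin n)) (μ : ℝ) : EuclideanSpace ℝ (Fin n) :=
  Matrix.toEuclideanLin (b x)⁻¹ (μ • Matrix.toEuclideanLin A x - d x)

/-- The closed-loop plant vector field `d(x) + b(x) u(x, μ)`. -/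
def closedLoopField {n : ℕ} (d : EuclideanSpace ℝ (Fin n) → EuclideanSpace ℝ (Fin n))
    (b : EuclideanSpace ℝ (Fin n) → Matrix (Fin n) (Fin n) ℝ) (A : Matrix (Fin n) (Fin n) ℝ)
    (x : EuclideanSpace ℝ (Fin n)) (μ : ℝ) : EuclideanSpace ℝ (Fin n) :=
  d x + Matrix.toEuclideanLin (b x) (regulationFeedback d b A x μ)

/-- The closed-loop hybrid system, with state `z = (x, τ, q, μ)`. Flows, for `τ ∈ [0, N₀]`:
`ẋ = d_q(x) + b_q(x) u_q(x, μ)`, `τ̇ ∈ μ [0, 1/τd]`, `q̇ = 0`, `μ̇ = (k/T) μ^{1+1/k}`.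
Jumps, for `τ ∈ [1, N₀]`: `x⁺ = x`, `τ⁺ = τ - 1`, `q⁺ ∈ {1,…,Q} \ {q}`, `μ⁺ = μ`.
The flow map of `blowUpSystem` is multiplied by `μ ≥ 1`, hence the factor `μ⁻¹` below. -/
def closedLoopSystem {n Q : ℕ}
    (d : Fin Q → EuclideanSpace ℝ (Fin n) → EuclideanSpace ℝ (Fin n))
    (b : Fin Q → EuclideanSpace ℝ (Fin n) → Matrix (Fin n) (Fin n) ℝ)
    (A : Fin Q → Matrix (Fin n) (Fin n) ℝ) (τd N₀ T k : ℝ) :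
    HybridSystem (EuclideanSpace ℝ ((Fin n ⊕ Fin 2) ⊕ Unit)) :=
  blowUpSystem T k (switchSet n Q 0 N₀) (switchSet n Q 1 N₀)
    (fun ψ μ => {v | (∃ i : Fin Q, qPart ψ = (i : ℝ) + 1 ∧
        xPart v = μ⁻¹ • closedLoopField (d i) (b i) (A i) (xPart ψ) μ) ∧
      tauPart v ∈ Icc 0 (1 / τd) ∧ qPart v = 0})
    (fun ψ => {w | xPart w = xPart ψ ∧ tauPart w = tauPart ψ - 1 ∧
      qPart w ∈ modeSet Q \ {qPart ψ}})

end

/-! The feedback cancels `d` and `b`, leaving `ẋ = μ A_q x`. The gain equation gives `dω(μ)/dt = μ`,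
so in the time `ω(μ)` the plant is a switched linear system with Hurwitz modes, whose switching is
limited by the timer `τ`.

Lyapunov's theorem (`IsHurwitz.exists_lyapunov_form`) supplies forms `B_q` with `‖x‖² ≤ B_q(x,x) ≤
C‖x‖²` and a common decay rate `lam` (`exists_uniform_lyapunov_forms`). The weighted function
`e^{Lτ} B_q(x,x) e^{cω(μ)}` does not increase along flows when `L/τd + c ≤ lam`
(`lyapunov_flow_le`). A jump lowers `τ` by one, and the resulting factor `e^{-L}` outweighs the loss
`C` from changing forms, with `e^{-1}` to spare (`energy_jump_le`). Induction over the jumps gives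
decay in both `ω` and `j` (`IsHybridSolution.energy_le`).

Two identifications finish the proof: the distance to the target is `‖x‖` (`infDist_target`), and
since `μ^{-1/k}` decreases linearly in `t`, the increment of `ω(μ)` is the prescribed time dilation
(`timeDilation_eq`). -/

/-! ### Lyapunov's theorem through the Cayley transform -/

theorem Complex.norm_lt_one_of_re_cayley_neg {ν : ℂ} (hν : ν ≠ -1)
    (h : ((ν - 1) / (ν + 1)).re < 0) : ‖ν‖ < 1 := by
  have hne : ν + 1 ≠ 0 := fun h0 => hν (eq_neg_of_add_eq_zero_left h0)
  have hpos : 0 < Complex.normSq (ν + 1) := Complex.normSq_pos.2 hne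
  -- The numerator of the real part is `|ν|² - 1`.
  rw [Complex.div_re, ← add_div, div_lt_iff₀ hpos, zero_mul] at h
  have h2 : ‖ν‖ ^ 2 < 1 := by
    rw [← Complex.normSq_eq_norm_sq, Complex.normSq_apply]
    simp at h
    nlinarith
  nlinarith [norm_nonneg ν]

section Cayley

variable {R : Type*} [NormedRing R] [NormedAlgebra ℂ R]

/-- For `m = (1 + a)(1 - a)⁻¹`, the identity `ν - m = ((ν - 1) - (ν + 1)a)(1 - a)⁻¹` carries a
spectral value `ν` of `m` to the spectral value `(ν - 1)/(ν + 1)` of `a`. At `ν = -1` the right side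
is a unit. -/
theorem exists_cayley_of_spectrum_re_neg {a : R} (ha : ∀ l ∈ spectrum ℂ a, l.re < 0) :
    ∃ m : R, IsUnit (1 - a) ∧ m * (1 - a) = 1 + a ∧ ∀ ν ∈ spectrum ℂ m, ‖ν‖ < 1 := by
  have h1 : IsUnit (1 - a) := by
    by_contra h
    have : (1 : ℂ) ∈ spectrum ℂ a := by simpa [spectrum.mem_iff] using h
    simpa using (ha 1 this).trans zero_lt_one
  obtain ⟨u, hu⟩ := h1
  refine ⟨(1 + a) * ↑u⁻¹, hu ▸ u.isUnit, by rw [← hu, mul_assoc, Units.inv_mul, mul_one], ?_⟩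
  intro ν hν
  have key : algebraMap ℂ R ν - (1 + a) * ↑u⁻¹ =
      (algebraMap ℂ R (ν - 1) - algebraMap ℂ R (ν + 1) * a) * ↑u⁻¹ := by
    have : algebraMap ℂ R ν = algebraMap ℂ R ν * (1 - a) * ↑u⁻¹ := by
      rw [← hu, mul_assoc, Units.mul_inv, mul_one]
    rw [this, ← sub_mul]
    simp only [map_sub, map_add, map_one]
    noncomm_ring
  rw [spectrum.mem_iff, key, Units.isUnit_mul_units] at hν
  have hne : ν ≠ -1 := by
    rintro rfl
    apply hν
    have : algebraMap ℂ R (-1 - 1) - algebraMap ℂ R (-1 + 1) * a = algebraMap ℂ R (-1 - 1) := by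
      simp
    rw [this]
    exact (IsUnit.mk0 (-1 - 1 : ℂ) (by norm_num)).map (algebraMap ℂ R)
  have hne' : ν + 1 ≠ 0 := fun h0 => hne (eq_neg_of_add_eq_zero_left h0)
  refine Complex.norm_lt_one_of_re_cayley_neg hne (ha _ ?_)
  rw [spectrum.mem_iff]
  contrapose! hν
  have e : algebraMap ℂ R (ν - 1) - algebraMap ℂ R (ν + 1) * a =
      algebraMap ℂ R (ν + 1) * (algebraMap ℂ R ((ν - 1) / (ν + 1)) - a) := by
    rw [mul_sub, ← map_mul, mul_div_cancel₀ _ hne']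
  rw [e]
  exact ((IsUnit.mk0 _ hne').map (algebraMap ℂ R)).mul hν

/-- Gelfand's formula, with `r` strictly between the spectral radius and 1. -/
theorem exists_eventually_norm_pow_le_of_spectrum [CompleteSpace R] {m : R} (hm : ∀ ν ∈ spectrum ℂ m, ‖ν‖ < 1) :
    ∃ r : ℝ, 0 ≤ r ∧ r < 1 ∧ ∀ᶠ k : ℕ in atTop, ‖m ^ k‖ ≤ r ^ k := by
  have hρ : spectralRadius ℂ m < 1 := by
    rcases (spectrum ℂ m).eq_empty_or_nonempty with h | h
    · simp [spectralRadius, h]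
    · exact_mod_cast spectrum.spectralRadius_lt_of_forall_lt_of_nonempty h (r := 1)
        fun k hk => by exact_mod_cast hm k hk
  obtain ⟨r, hr0, hr1⟩ := exists_between hρ
  lift r to NNReal using hr1.ne_top
  refine ⟨r, r.2, by exact_mod_cast hr1, ?_⟩
  filter_upwards [(spectrum.pow_nnnorm_pow_one_div_tendsto_nhds_spectralRadius m).eventually_lt_const hr0,
    eventually_gt_atTop 0] with k hk hk0
  have hk' : (0 : ℝ) < k := by exact_mod_cast hk0
  have := ENNReal.rpow_le_rpow hk.le hk'.le
  rw [← ENNReal.rpow_mul, one_div_mul_cancel hk'.ne', ENNReal.rpow_one, ENNReal.rpow_natCast] at this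
  exact_mod_cast this

end Cayley

section Lyapunov

variable {H : Type*} [NormedAddCommGroup H] [InnerProductSpace ℂ H] [CompleteSpace H]

open ContinuousLinearMap in
-- `P = ∑ (Mᵏ)* Mᵏ` converges geometrically. Conjugating by `M` shifts the index and drops the term
-- `k = 0`, which is the identity and also gives the lower bound.
theorem exists_stein_solution {M : H →L[ℂ] H} (hM : ∀ ν ∈ spectrum ℂ M, ‖ν‖ < 1) :
    ∃ P : H →L[ℂ] H, star M * P * M = P - 1 ∧ ∀ x, ‖x‖ ^ 2 ≤ (inner ℂ x (P x)).re := by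
  obtain ⟨r, hr0, hr1, hr⟩ := exists_eventually_norm_pow_le_of_spectrum hM
  have hs : Summable fun k : ℕ => star (M ^ k) * M ^ k := by
    refine Summable.of_norm_bounded_eventually_nat (g := fun k => r ^ k)
      (summable_geometric_of_lt_one hr0 hr1) ?_
    filter_upwards [hr] with k hk
    calc ‖star (M ^ k) * M ^ k‖ ≤ ‖star (M ^ k)‖ * ‖M ^ k‖ := norm_mul_le _ _
      _ = ‖M ^ k‖ * ‖M ^ k‖ := by rw [norm_star]
      _ ≤ r ^ k * 1 := mul_le_mul hk (hk.trans (pow_le_one₀ hr0 hr1.le)) (norm_nonneg _)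
          (pow_nonneg hr0 k)
      _ = r ^ k := mul_one _
  refine ⟨∑' k : ℕ, star (M ^ k) * M ^ k, ?_, fun x => ?_⟩
  · conv_rhs => rw [hs.tsum_eq_zero_add]
    rw [← hs.tsum_mul_left, ← (hs.mul_left _).tsum_mul_right]
    simp only [pow_zero, star_one, mul_one, add_sub_cancel_left]
    refine tsum_congr fun k => ?_
    rw [pow_succ, star_mul]
    noncomm_ring
  · let φ : (H →L[ℂ] H) →L[ℝ] ℝ :=
      Complex.reCLM.comp (((innerSL ℂ x).comp (apply ℂ H x)).restrictScalars ℝ)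
    have hφ : ∀ S, φ S = (inner ℂ x (S x)).re := fun S => rfl
    have h := φ.hasSum hs.hasSum
    have hk : ∀ k, φ (star (M ^ k) * M ^ k) = ‖(M ^ k) x‖ ^ 2 := fun k => by
      rw [hφ, mul_apply_eq_comp, star_eq_adjoint, adjoint_inner_right, inner_self_eq_norm_sq_to_K]
      norm_cast
    have h0 := le_hasSum h 0 fun k _ => by
      change 0 ≤ φ _
      rw [hk]; positivity
    rw [hk] at h0
    simpa [hφ] using h0

/-- **Lyapunov's theorem**: an operator with spectrum in the open left half-plane has a quadratic
Lyapunov function. -/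
theorem exists_lyapunov_solution {T : H →L[ℂ] H} (hT : ∀ l ∈ spectrum ℂ T, l.re < 0) :
    ∃ (P : H →L[ℂ] H) (c : ℝ), 0 < c ∧ ∀ x, ‖x‖ ^ 2 ≤ (inner ℂ x (P x)).re ∧
      (inner ℂ (T x) (P x)).re + (inner ℂ x (P (T x))).re ≤ -c * ‖x‖ ^ 2 := by
  obtain ⟨M, ⟨u, hu⟩, hM, hspec⟩ := exists_cayley_of_spectrum_re_neg hT
  obtain ⟨P, hP, hpos⟩ := exists_stein_solution hspec
  set N : H →L[ℂ] H := ↑u⁻¹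
  refine ⟨P, 1 / (2 * (‖N‖ + 1) ^ 2), by positivity, fun x => ⟨hpos x, ?_⟩⟩
  -- With `y = (1 - T)x` and `My = (1 + T)x`, the Stein identity at `y` says that twice the Lyapunov
  -- expression at `x` equals `-‖y‖²`. The constant then comes from `‖x‖ ≤ ‖(1 - T)⁻¹‖ ‖y‖`.
  set y := x - T x with hy
  have hMy : M y = x + T x := by
    have := congrArg (fun S : H →L[ℂ] H => S x) hM
    simpa [hy] using this
  have hNy : N y = x := by
    have : N * (1 - T) = 1 := by rw [← hu]; exact u.inv_mul
    have := congrArg (fun S : H →L[ℂ] H => S x) this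
    simpa [hy] using this
  have h1 : (inner ℂ (M y) (P (M y))).re = (inner ℂ y (P y)).re - ‖y‖ ^ 2 := by
    have := congrArg (fun S : H →L[ℂ] H => (inner ℂ y (S y)).re) hP
    simp only [mul_apply_eq_comp, ContinuousLinearMap.star_eq_adjoint,
      ContinuousLinearMap.adjoint_inner_right, sub_apply,
      one_apply_eq_self, inner_sub_right, Complex.sub_re,
      inner_self_eq_norm_sq_to_K] at this
    rw [this]
    norm_cast
  rw [hMy, hy] at h1
  simp only [map_add, map_sub, inner_add_left, inner_add_right, inner_sub_left, inner_sub_right,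
    Complex.add_re, Complex.sub_re] at h1
  rw [← hy] at h1
  have h2 : ‖x‖ ≤ (‖N‖ + 1) * ‖y‖ := by
    calc ‖x‖ = ‖N y‖ := by rw [hNy]
      _ ≤ ‖N‖ * ‖y‖ := N.le_opNorm y
      _ ≤ (‖N‖ + 1) * ‖y‖ := by nlinarith [norm_nonneg y]
  have h3 : ‖x‖ ^ 2 ≤ (‖N‖ + 1) ^ 2 * ‖y‖ ^ 2 := by
    rw [← mul_pow]; exact pow_le_pow_left₀ (norm_nonneg x) h2 2
  have h4 : 1 / (2 * (‖N‖ + 1) ^ 2) * ‖x‖ ^ 2 ≤ ‖y‖ ^ 2 / 2 := by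
    rw [one_div_mul_eq_div, div_le_div_iff₀ (by positivity) two_pos]
    nlinarith
  linarith

end Lyapunov

theorem IsHurwitz.exists_lyapunov_form {n : ℕ} {A : Matrix (Fin n) (Fin n) ℝ} (hA : IsHurwitz A) :
    ∃ (B : EuclideanSpace ℝ (Fin n) →L[ℝ] EuclideanSpace ℝ (Fin n) →L[ℝ] ℝ) (c : ℝ), 0 < c ∧
      ∀ x, ‖x‖ ^ 2 ≤ B x x ∧ B (Matrix.toEuclideanLin A x) x + B x (Matrix.toEuclideanLin A x) ≤
        -c * ‖x‖ ^ 2 := by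
  set T := Matrix.toEuclideanCLM (n := Fin n) (𝕜 := ℂ) (A.map (algebraMap ℝ ℂ)) with hTdef
  have hT : ∀ l ∈ spectrum ℂ T, l.re < 0 := by
    intro l hl
    rw [hTdef, AlgEquiv.spectrum_eq] at hl
    exact hA l hl
  obtain ⟨P, c, hc, hP⟩ := exists_lyapunov_solution hT
  -- Real vectors embed isometrically in `ℂⁿ`, intertwining `A` with its complexification; the real
  -- part of the Hermitian form is pulled back along this embedding.
  let ι : EuclideanSpace ℝ (Fin n) →ₗ[ℝ] EuclideanSpace ℂ (Fin n) :=
    { toFun := fun x => WithLp.toLp 2 fun i => (x i : ℂ)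
      map_add' := fun x y => by ext i; simp
      map_smul' := fun r x => by ext i; simp }
  have hι : ∀ x, ‖ι x‖ = ‖x‖ := fun x => by
    simp [EuclideanSpace.norm_eq, ι]
  have hTι : ∀ x, T (ι x) = ι (Matrix.toEuclideanLin A x) := fun x => by
    ext i
    simp [hTdef, ι, Matrix.mulVec, dotProduct, Matrix.toLpLin_apply]
  let b : EuclideanSpace ℝ (Fin n) →ₗ[ℝ] EuclideanSpace ℝ (Fin n) →ₗ[ℝ] ℝ :=
    LinearMap.mk₂ ℝ (fun x y => (inner ℂ (ι x) (P (ι y))).re)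
      (fun x x' y => by simp)
      (fun r x y => by simp [inner_smul_left_eq_smul])
      (fun x y y' => by simp)
      (fun r x y => by simp [inner_smul_right_eq_smul])
  let B : EuclideanSpace ℝ (Fin n) →L[ℝ] EuclideanSpace ℝ (Fin n) →L[ℝ] ℝ :=
    LinearMap.toContinuousLinearMap
      ((LinearMap.toContinuousLinearMap : (EuclideanSpace ℝ (Fin n) →ₗ[ℝ] ℝ) ≃ₗ[ℝ] _).toLinearMap ∘ₗ b)
  have hB : ∀ x y, B x y = (inner ℂ (ι x) (P (ι y))).re := fun x y => rfl
  refine ⟨B, c, hc, fun x => ?_⟩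
  have := hP (ι x)
  rw [hTι, hι] at this
  simpa [hB] using this

/-! ### Absolutely continuous functions and almost-everywhere conditions -/

section AbsolutelyContinuous

theorem LipschitzOnWith.comp_absolutelyContinuousOnInterval {X Y : Type*} [PseudoMetricSpace X]
    [PseudoMetricSpace Y] {f : ℝ → X} {g : X → Y} {s : Set X} {K : NNReal} {a b : ℝ}
    (hg : LipschitzOnWith K g s) (hf : AbsolutelyContinuousOnInterval f a b)
    (hs : MapsTo f (uIcc a b) s) : AbsolutelyContinuousOnInterval (g ∘ f) a b := by
  have h0 := Filter.Tendsto.const_mul (K : ℝ) hf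
  rw [mul_zero] at h0
  refine squeeze_zero' (Eventually.of_forall fun E => Finset.sum_nonneg fun i _ => dist_nonneg) ?_ h0
  filter_upwards [mem_inf_of_right (mem_principal_self _)] with E hE
  rw [Finset.mul_sum]
  refine Finset.sum_le_sum fun i hi => ?_
  exact hg.dist_le_mul _ (hs (hE.1 i hi).1) _ (hs (hE.1 i hi).2)

/-- The curve is bounded, so it stays in a compact convex part of `s`, where `g` is Lipschitz. -/
theorem ContDiffOn.comp_absolutelyContinuousOnInterval {X Y : Type*} [NormedAddCommGroup X]
    [NormedSpace ℝ X] [FiniteDimensional ℝ X] [NormedAddCommGroup Y] [NormedSpace ℝ Y]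
    {f : ℝ → X} {g : X → Y} {s : Set X} {a b : ℝ} (hg : ContDiffOn ℝ 1 g s) (hsc : Convex ℝ s)
    (hs : IsClosed s) (hf : AbsolutelyContinuousOnInterval f a b) (hfs : MapsTo f (uIcc a b) s) :
    AbsolutelyContinuousOnInterval (g ∘ f) a b := by
  have : ProperSpace X := FiniteDimensional.proper ℝ X
  obtain ⟨C, hC⟩ := hf.exists_bound
  obtain ⟨K, hK⟩ := (hg.mono (inter_subset_left : s ∩ Metric.closedBall 0 C ⊆ s)).exists_lipschitzOnWith
    one_ne_zero (hsc.inter (convex_closedBall 0 C)) ((isCompact_closedBall 0 C).inter_left hs)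
  exact hK.comp_absolutelyContinuousOnInterval hf fun t ht => ⟨hfs ht, by simpa using hC t ht⟩

theorem AbsolutelyContinuousOnInterval.le_of_ae_hasDerivAt_nonpos {f : ℝ → ℝ} {a b : ℝ}
    (hab : a ≤ b) (hf : AbsolutelyContinuousOnInterval f a b)
    (hd : ∀ᵐ t ∂volume, t ∈ Ioo a b → ∃ v ≤ 0, HasDerivAt f v t) : f b ≤ f a := by
  have h := hf.integral_deriv_eq_sub
  have h1 : ∫ x in a..b, deriv f x ≤ 0 := by
    rw [intervalIntegral.integral_of_le hab, integral_Ioc_eq_integral_Ioo]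
    refine setIntegral_nonpos_ae measurableSet_Ioo ?_
    filter_upwards [hd] with t ht hmem
    obtain ⟨v, hv, hv'⟩ := ht hmem
    rwa [hv'.deriv]
  linarith

theorem AbsolutelyContinuousOnInterval.sub_eq_of_ae_hasDerivAt {f : ℝ → ℝ} {a b c : ℝ}
    (hab : a ≤ b) (hf : AbsolutelyContinuousOnInterval f a b)
    (hd : ∀ᵐ t ∂volume, t ∈ Ioo a b → HasDerivAt f c t) : f b - f a = c * (b - a) := by
  rw [← hf.integral_deriv_eq_sub, intervalIntegral.integral_of_le hab,
    integral_Ioc_eq_integral_Ioo, setIntegral_congr_ae measurableSet_Ioo (g := fun _ => c)]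
  · simp [hab, mul_comm]
  · filter_upwards [hd] with t ht hmem
    exact (ht hmem).deriv

end AbsolutelyContinuous

/-- The exceptional interior times form an open null set, hence none exist; the endpoints follow by
closure. -/
theorem ContinuousOn.mapsTo_Icc_of_ae_mem_Ioo {X : Type*} [TopologicalSpace X] {f : ℝ → X}
    {a b : ℝ} (hab : a < b) (hf : ContinuousOn f (Icc a b)) {s : Set X} (hs : IsClosed s)
    (h : ∀ᵐ t ∂volume, t ∈ Ioo a b → f t ∈ s) : MapsTo f (Icc a b) s := by
  have h1 : MapsTo f (Ioo a b) s := by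
    intro t ht
    by_contra hts
    have ho : IsOpen (Ioo a b ∩ f ⁻¹' sᶜ) :=
      (hf.mono Ioo_subset_Icc_self).isOpen_inter_preimage isOpen_Ioo hs.isOpen_compl
    have hpos := ho.measure_pos volume ⟨t, ht, hts⟩
    refine hpos.ne' (measure_mono_null ?_ (ae_iff.1 h))
    rintro u ⟨hu, hus⟩ hcon
    exact hus (hcon hu)
  intro t ht
  rw [← closure_Ioo hab.ne] at ht hf
  simpa [hs.closure_eq] using h1.closure_of_continuousOn hf ht

/-! ### The gain equation, time dilation and decay along flows -/

theorem hasDerivAt_omegaFun {T k m : ℝ} (hk : 1 ≤ k) (hm : 0 < m) :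
    HasDerivAt (fun y => omegaFun T k y 1) (T / k * m ^ (-(1 / k))) m := by
  rcases eq_or_ne k 1 with rfl | h1
  · have := ((Real.hasDerivAt_log hm.ne').sub_const (Real.log 1)).const_mul T
    simpa [omegaFun, Real.rpow_neg_one] using this
  · have hk0 : k ≠ 0 := by positivity
    have hk1 : k - 1 ≠ 0 := sub_ne_zero.2 h1
    have := ((((Real.hasDerivAt_rpow_const (p := (k - 1) / k) (Or.inl hm.ne')).sub_const 1).div_const
      ((k - 1) / k)).sub_const (((1 : ℝ) ^ ((k - 1) / k) - 1) / ((k - 1) / k))).const_mul (T / k)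
    simp only [omegaFun, if_neg h1]
    convert! this using 1
    rw [mul_div_cancel_left₀ _ (div_ne_zero hk1 hk0)]
    congr 2
    field_simp
    ring

theorem contDiffOn_omegaFun {T k : ℝ} :
    ContDiffOn ℝ 1 (fun y => omegaFun T k y 1) (Ici 1) := by
  have h0 : ∀ y ∈ Ici (1 : ℝ), y ≠ 0 := fun y hy => (zero_lt_one.trans_le hy).ne'
  by_cases h1 : k = 1
  · simp only [omegaFun, if_pos h1]
    exact contDiffOn_const.mul ((contDiffOn_id.log h0).sub contDiffOn_const)
  · simp only [omegaFun, if_neg h1]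
    exact contDiffOn_const.mul ((((contDiffOn_id.rpow_const_of_ne h0).sub contDiffOn_const).div_const
      _).sub contDiffOn_const)

theorem omegaFun_sub_omegaFun (T k b a : ℝ) :
    omegaFun T k b 1 - omegaFun T k a 1 = omegaFun T k b a := by
  unfold omegaFun
  split_ifs <;> ring

/-- The hypothesis is the integrated gain equation; solving it for `μ` gives the explicit blow-up
formula. -/
theorem blowUpGain_eq {T k μ₀ μ t : ℝ} (hT : 0 < T) (hk : 0 < k) (hμ : 0 < μ)
    (h : μ ^ (-(1 / k)) - μ₀ ^ (-(1 / k)) = -(1 / T) * t) : blowUpGain T k μ₀ t = μ := by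
  have h1 : prescribedTime T k μ₀ - t = T * μ ^ (-(1 / k)) := by
    unfold prescribedTime
    field_simp at h
    linear_combination -h
  unfold blowUpGain
  rw [h1, Real.mul_rpow hT.le (by positivity), ← Real.rpow_mul hμ.le]
  have : -(1 / k) * k = -1 := by field_simp
  rw [this, Real.rpow_neg_one, div_mul_cancel_left₀ (by positivity), inv_inv]

theorem timeDilation_eq {T k μ₀ μ t : ℝ} (hT : 0 < T) (hk : 0 < k) (hμ₀ : 0 < μ₀) (hμ : 0 < μ)
    (h : μ ^ (-(1 / k)) - μ₀ ^ (-(1 / k)) = -(1 / T) * t) :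
    timeDilation T k μ₀ t = omegaFun T k μ 1 - omegaFun T k μ₀ 1 := by
  rw [timeDilation, blowUpGain_eq hT hk hμ h, blowUpGain_eq hT hk hμ₀ (by simp),
    omegaFun_sub_omegaFun]

section Flow

variable {T k a b : ℝ} {μ : ℝ → ℝ}

/-- The power `-1/k` linearises the gain equation: its derivative along the flow is the constant
`-1/T`. -/
theorem blowUp_flow_rpow (hT : 0 < T) (hk : 1 ≤ k) (hab : a ≤ b)
    (hμ : AbsolutelyContinuousOnInterval μ a b) (hμ1 : ∀ t ∈ Icc a b, 1 ≤ μ t)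
    (hd : ∀ᵐ t ∂volume, t ∈ Ioo a b → HasDerivAt μ (k / T * μ t ^ (1 + 1 / k)) t) :
    μ b ^ (-(1 / k)) - μ a ^ (-(1 / k)) = -(1 / T) * (b - a) := by
  have hc : ContDiffOn ℝ 1 (fun y : ℝ => y ^ (-(1 / k))) (Ici 1) :=
    contDiffOn_id.rpow_const_of_ne fun y hy => (zero_lt_one.trans_le hy).ne'
  refine (hc.comp_absolutelyContinuousOnInterval (convex_Ici 1) isClosed_Ici hμ
    (by rwa [uIcc_of_le hab])).sub_eq_of_ae_hasDerivAt hab ?_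
  filter_upwards [hd] with t ht hmem
  have hpos : 0 < μ t := zero_lt_one.trans_le (hμ1 t (Ioo_subset_Icc_self hmem))
  convert! (ht hmem).rpow_const (p := -(1 / k)) (Or.inl hpos.ne') using 1
  have e : μ t ^ (1 + 1 / k) * μ t ^ (-(1 / k) - 1) = 1 := by
    rw [← Real.rpow_add hpos, show 1 + 1 / k + (-(1 / k) - 1) = 0 by ring, Real.rpow_zero]
  have hk0 : k ≠ 0 := by positivity
  calc -(1 / T) = -(1 / T) * (μ t ^ (1 + 1 / k) * μ t ^ (-(1 / k) - 1)) := by rw [e, mul_one]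
    _ = _ := by field_simp

/-- The function `e^{Lτ} B(x, x) e^{cω(μ)}` does not increase along flows. -/
theorem lyapunov_flow_le {E : Type*} [NormedAddCommGroup E] [NormedSpace ℝ E]
    [FiniteDimensional ℝ E] {B : E →L[ℝ] E →L[ℝ] ℝ} {S : E → E} {lam c L τd : ℝ}
    {x : ℝ → E} {τ : ℝ → ℝ}
    (hB : ∀ x, 0 ≤ B x x) (hS : ∀ x, B (S x) x + B x (S x) ≤ -lam * B x x)
    (hL : 0 ≤ L) (hlam : L / τd + c ≤ lam)
    (hT : 0 < T) (hk : 1 ≤ k) (hab : a ≤ b)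
    (hx : AbsolutelyContinuousOnInterval x a b) (hτ : AbsolutelyContinuousOnInterval τ a b)
    (hμ : AbsolutelyContinuousOnInterval μ a b) (hμ1 : ∀ t ∈ Icc a b, 1 ≤ μ t)
    (hd : ∀ᵐ t ∂volume, t ∈ Ioo a b → HasDerivAt μ (k / T * μ t ^ (1 + 1 / k)) t ∧
      HasDerivAt x (μ t • S (x t)) t ∧ ∃ v ≤ μ t * (1 / τd), HasDerivAt τ v t) :
    Real.exp (L * τ b) * B (x b) (x b) * Real.exp (c * omegaFun T k (μ b) 1) ≤
      Real.exp (L * τ a) * B (x a) (x a) * Real.exp (c * omegaFun T k (μ a) 1) := by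
  have h1 : AbsolutelyContinuousOnInterval (fun t => Real.exp (L * τ t)) a b :=
    (ContDiff.contDiffOn (f := fun y : ℝ => Real.exp (L * y)) (by fun_prop)
      ).comp_absolutelyContinuousOnInterval convex_univ isClosed_univ hτ (mapsTo_univ _ _)
  have h2 : AbsolutelyContinuousOnInterval (fun t => B (x t) (x t)) a b :=
    (ContDiff.contDiffOn (f := fun y : E => B y y) (by fun_prop)
      ).comp_absolutelyContinuousOnInterval convex_univ isClosed_univ hx (mapsTo_univ _ _)
  have h3 : AbsolutelyContinuousOnInterval (fun t => Real.exp (c * omegaFun T k (μ t) 1)) a b :=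
    ((contDiffOn_const (c := c)).mul contDiffOn_omegaFun).exp.comp_absolutelyContinuousOnInterval
      (convex_Ici 1) isClosed_Ici hμ (by rwa [uIcc_of_le hab])
  refine ((h1.fun_mul h2).fun_mul h3).le_of_ae_hasDerivAt_nonpos hab ?_
  filter_upwards [hd] with t ht hmem
  obtain ⟨hμ', hx', v, hv, hτ'⟩ := ht hmem
  have hpos : 0 < μ t := zero_lt_one.trans_le (hμ1 t (Ioo_subset_Icc_self hmem))
  have d1 := (hτ'.const_mul L).exp
  have d2 : HasDerivAt (fun t => B (x t) (x t)) (B (μ t • S (x t)) (x t) + B (x t) (μ t • S (x t))) t :=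
    (B.hasFDerivAt.comp_hasDerivAt t hx').clm_apply hx'
  have d3 := (((hasDerivAt_omegaFun (T := T) hk hpos).comp t hμ').const_mul c).exp
  -- This is `dω(μ)/dt = μ`: the flow of `x` has unit speed factor in the time `ω`.
  have e : T / k * μ t ^ (-(1 / k)) * (k / T * μ t ^ (1 + 1 / k)) = μ t := by
    have : μ t ^ (-(1 / k)) * μ t ^ (1 + 1 / k) = μ t := by
      rw [← Real.rpow_add hpos]
      simp
    have hk0 : k ≠ 0 := by positivity
    calc _ = μ t ^ (-(1 / k)) * μ t ^ (1 + 1 / k) := by field_simp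
      _ = _ := this
  rw [e] at d3
  refine ⟨_, ?_, (d1.mul d2).mul d3⟩
  simp only [Function.comp_apply, map_smul, smul_apply, smul_eq_mul,
    Pi.mul_apply]
  have hV := hB (x t)
  -- The derivative of the product, stripped of its positive exponential factors.
  have h4 : L * v * B (x t) (x t) + μ t * (B (S (x t)) (x t) + B (x t) (S (x t)))
      + c * μ t * B (x t) (x t) ≤ 0 := by
    have i1 : L * v * B (x t) (x t) ≤ L * (μ t * (1 / τd)) * B (x t) (x t) := by gcongr
    have i2 := mul_le_mul_of_nonneg_left (hS (x t)) hpos.le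
    have i3 := mul_le_mul_of_nonneg_left hlam (mul_nonneg hpos.le hV)
    rw [div_eq_mul_one_div] at i3
    nlinarith
  have h5 := mul_nonpos_of_nonneg_of_nonpos
    (mul_nonneg (Real.exp_nonneg (L * τ t)) (Real.exp_nonneg (c * omegaFun T k (μ t) 1))) h4
  linarith

end Flow

/-! ### Jump times of a hybrid time domain -/

theorem IsHybridTimeDomain.exists_partition {E : Set (ℝ × ℕ)} (hE : IsHybridTimeDomain E) {t : ℝ}
    {j : ℕ} (h : (t, j) ∈ E) : ∃ s : ℕ → ℝ, s 0 = 0 ∧ s (j + 1) = t ∧ (∀ i ≤ j, s i ≤ s (i + 1)) ∧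
      ∀ i ≤ j, Icc (s i) (s (i + 1)) ⊆ flowInterval E i := by
  obtain ⟨J, s, hs0, hmono, heq⟩ := hE.2 _ h
  have hmem : ∀ u i, (u, i) ∈ E ∧ 0 ≤ u ∧ u ≤ t ∧ i ≤ j ↔ i < J ∧ s i ≤ u ∧ u ≤ s (i + 1) :=
    fun u i => by simpa using Set.ext_iff.1 heq (u, i)
  obtain ⟨hjJ, -, htj⟩ := (hmem t j).1 ⟨h, hE.1 _ h, le_rfl, le_rfl⟩
  refine ⟨s, hs0, le_antisymm ?_ htj, fun i hi => hmono i (hi.trans_lt hjJ), fun i hi u hu =>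
    ((hmem u i).2 ⟨hi.trans_lt hjJ, hu⟩).1⟩
  -- The right end of the `j`-th interval lies in the truncation at `(t, j)`, hence is at most `t`.
  exact ((hmem (s (j + 1)) j).2 ⟨hjJ, hmono j hjJ, le_rfl⟩).2.2.1

/-! ### The closed loop: projections, distance to the target, flow directions -/

section ClosedLoop

variable {n Q : ℕ}

local notation "FullState" => EuclideanSpace ℝ ((Fin n ⊕ Fin 2) ⊕ Unit)

/-- The projection `z = (x, τ, q, μ) ↦ x`. -/
noncomputable def xProj (n : ℕ) :
    EuclideanSpace ℝ ((Fin n ⊕ Fin 2) ⊕ Unit) →L[ℝ] EuclideanSpace ℝ (Fin n) :=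
  LinearMap.toContinuousLinearMap
    { toFun := fun z => xPart (psiPart z)
      map_add' := fun _ _ => rfl
      map_smul' := fun _ _ => rfl }

/-- The projection `z = (x, τ, q, μ) ↦ τ`. -/
noncomputable def tauProj (n : ℕ) : EuclideanSpace ℝ ((Fin n ⊕ Fin 2) ⊕ Unit) →L[ℝ] ℝ :=
  EuclideanSpace.proj (Sum.inl (Sum.inr 0))

/-- The projection `z = (x, τ, q, μ) ↦ q`. -/
noncomputable def qProj (n : ℕ) : EuclideanSpace ℝ ((Fin n ⊕ Fin 2) ⊕ Unit) →L[ℝ] ℝ :=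
  EuclideanSpace.proj (Sum.inl (Sum.inr 1))

/-- The projection `z = (x, τ, q, μ) ↦ μ`. -/
noncomputable def muProj (n : ℕ) : EuclideanSpace ℝ ((Fin n ⊕ Fin 2) ⊕ Unit) →L[ℝ] ℝ :=
  EuclideanSpace.proj (Sum.inr ())

theorem modeSet_finite (Q : ℕ) : (modeSet Q).Finite :=
  (Set.finite_range fun i : Fin Q => (i : ℝ) + 1).subset fun _ ⟨i, hi⟩ => ⟨i, hi.symm⟩

theorem isCompact_targetSet (n Q : ℕ) (N₀ : ℝ) : IsCompact (targetSet n Q N₀) := by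
  let f : ℝ × ℝ → SwitchState n := fun p => WithLp.toLp 2 (Sum.elim (fun _ => 0) ![p.1, p.2])
  have hf : Continuous f := by
    refine (PiLp.continuous_toLp 2 _).comp (continuous_pi ?_)
    rintro (i | i)
    · exact continuous_const
    · fin_cases i
      · exact continuous_fst
      · exact continuous_snd
  have : targetSet n Q N₀ = f '' (Icc 0 N₀ ×ˢ modeSet Q) := by
    ext ψ
    constructor
    · rintro ⟨hx, hτ, hq⟩
      refine ⟨(tauPart ψ, qPart ψ), ⟨hτ, hq⟩, ?_⟩
      ext (i | i)
      · have := congrArg (fun y : EuclideanSpace ℝ (Fin n) => y i) hx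
        simpa [xPart, f] using this.symm
      · fin_cases i <;> rfl
    · rintro ⟨p, ⟨hτ, hq⟩, rfl⟩
      exact ⟨by ext i; simp [xPart, f], hτ, hq⟩
  rw [this]
  exact (isCompact_Icc.prod (modeSet_finite Q).isCompact).image hf

theorem norm_xProj_le (z : FullState) : ‖xProj n z‖ ≤ ‖z‖ := by
  simp only [EuclideanSpace.norm_eq, Fintype.sum_sum_type]
  refine Real.sqrt_le_sqrt ?_
  have : ∀ i, xProj n z i = z (Sum.inl (Sum.inl i)) := fun i => rfl
  simp only [this]
  have h1 : 0 ≤ ∑ i, ‖z (Sum.inl (Sum.inr i))‖ ^ 2 := by positivity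
  have h2 : 0 ≤ ∑ i, ‖z (Sum.inr i)‖ ^ 2 := by positivity
  linarith

/-- Setting `x` to zero gives a nearest point, because `τ`, `q` and `μ` already satisfy the
constraints. -/
theorem infDist_target {N₀ : ℝ} {z : FullState} (hz : psiPart z ∈ switchSet n Q 0 N₀)
    (hμ : 1 ≤ muPart z) :
    Metric.infDist z {y | psiPart y ∈ targetSet n Q N₀ ∧ 1 ≤ muPart y} = ‖xProj n z‖ := by
  let w : FullState := WithLp.toLp 2 (Sum.elim (Sum.elim (fun _ => 0)
    fun i => z (Sum.inl (Sum.inr i))) fun i => z (Sum.inr i))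
  have hw : w ∈ {y | psiPart y ∈ targetSet n Q N₀ ∧ 1 ≤ muPart y} :=
    ⟨⟨by ext i; simp [w, xPart, psiPart], hz⟩, hμ⟩
  refine le_antisymm ((Metric.infDist_le_dist_of_mem hw).trans_eq ?_) ?_
  · rw [EuclideanSpace.dist_eq, EuclideanSpace.norm_eq]
    simp [Fintype.sum_sum_type, w, dist_eq_norm]
    rfl
  · refine (Metric.le_infDist ⟨w, hw⟩).2 fun y hy => ?_
    have h0 : xProj n y = 0 := hy.1.1
    calc ‖xProj n z‖ = ‖xProj n (z - y)‖ := by rw [map_sub, h0, sub_zero]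
      _ ≤ ‖z - y‖ := norm_xProj_le _
      _ = dist z y := (dist_eq_norm _ _).symm

theorem closedLoopField_eq {d : EuclideanSpace ℝ (Fin n) → EuclideanSpace ℝ (Fin n)}
    {b : EuclideanSpace ℝ (Fin n) → Matrix (Fin n) (Fin n) ℝ} {x : EuclideanSpace ℝ (Fin n)}
    (hb : IsUnit (b x)) (A : Matrix (Fin n) (Fin n) ℝ) (μ : ℝ) :
    closedLoopField d b A x μ = μ • Matrix.toEuclideanLin A x := by
  have hdet : IsUnit (b x).det := (Matrix.isUnit_iff_isUnit_det _).1 hb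
  have h : ∀ y, Matrix.toEuclideanLin (b x) (Matrix.toEuclideanLin (b x)⁻¹ y) = y := fun y => by
    ext i
    simp [Matrix.toLpLin_apply, Matrix.mulVec_mulVec, Matrix.mul_nonsing_inv _ hdet]
  rw [closedLoopField, regulationFeedback, h, add_sub_cancel]

variable {d : Fin Q → EuclideanSpace ℝ (Fin n) → EuclideanSpace ℝ (Fin n)}
  {b : Fin Q → EuclideanSpace ℝ (Fin n) → Matrix (Fin n) (Fin n) ℝ}
  {A : Fin Q → Matrix (Fin n) (Fin n) ℝ} {τd N₀ T k : ℝ}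

theorem mem_closedLoopSystem_F (hb : ∀ q x, IsUnit (b q x)) {z v : FullState} (hμ : 1 ≤ muPart z)
    (hv : v ∈ (closedLoopSystem d b A τd N₀ T k).F z) {m : Fin Q} (hm : qPart (psiPart z) = m + 1) :
    xProj n v = muProj n z • Matrix.toEuclideanLin (A m) (xProj n z) ∧
      tauProj n v ≤ muProj n z * (1 / τd) ∧ muProj n v = k / T * muProj n z ^ (1 + 1 / k) := by
  change _ = muPart z • _ ∧ _ ≤ muPart z * _ ∧ _ = k / T * muPart z ^ _
  obtain ⟨⟨w, ⟨⟨i, hi, hx⟩, hτ, -⟩, hwv⟩, hμ'⟩ := hv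
  have hμ0 : 0 < muPart z := zero_lt_one.trans_le hμ
  have him : i = m := by
    have : (i : ℝ) = m := by linarith
    exact Fin.ext (by exact_mod_cast this)
  subst him
  rw [closedLoopField_eq (hb _ _), inv_smul_smul₀ hμ0.ne'] at hx
  have h1 : xProj n v = muPart z • xPart w := by
    change xPart (psiPart v) = _
    rw [← hwv]
    rfl
  have h2 : tauProj n v = muPart z * tauPart w := by
    change tauPart (psiPart v) = _
    rw [← hwv]
    rfl
  refine ⟨by rw [h1, hx]; rfl, ?_, hμ'⟩
  rw [h2]
  exact mul_le_mul_of_nonneg_left hτ.2 hμ0.le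

theorem qProj_eq_zero_of_mem_F {z v : FullState}
    (hv : v ∈ (closedLoopSystem d b A τd N₀ T k).F z) : qProj n v = 0 := by
  obtain ⟨⟨w, ⟨-, -, hq⟩, hwv⟩, -⟩ := hv
  change qPart (psiPart v) = 0
  rw [← hwv]
  change muPart z * qPart w = 0
  rw [hq, mul_zero]

/-- `z` lies in the flow set, with `q` equal to the mode indexed by `m`. -/
def InMode (n Q : ℕ) (N₀ : ℝ) (m : Fin Q) (z : EuclideanSpace ℝ ((Fin n ⊕ Fin 2) ⊕ Unit)) : Prop :=
  tauProj n z ∈ Icc 0 N₀ ∧ qProj n z = m + 1 ∧ 1 ≤ muProj n z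

theorem InMode.mem_switchSet {m : Fin Q} {z : FullState} (hz : InMode n Q N₀ m z) :
    psiPart z ∈ switchSet n Q 0 N₀ :=
  ⟨hz.1, m, hz.2.1⟩

/-- The Lyapunov function `e^{Lτ} B(x, x) e^{cω(μ)}`. -/
noncomputable def energy (L c T k : ℝ)
    (B : EuclideanSpace ℝ (Fin n) →L[ℝ] EuclideanSpace ℝ (Fin n) →L[ℝ] ℝ)
    (z : EuclideanSpace ℝ ((Fin n ⊕ Fin 2) ⊕ Unit)) : ℝ :=
  Real.exp (L * tauProj n z) * B (xProj n z) (xProj n z) *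
    Real.exp (c * omegaFun T k (muProj n z) 1)

/-! ### Energy along flows, across jumps and along solutions -/

section Steps

variable {B : Fin Q → EuclideanSpace ℝ (Fin n) →L[ℝ] EuclideanSpace ℝ (Fin n) →L[ℝ] ℝ}
  {lam c L C : ℝ}

theorem IsHybridSolution.flow_step (hb : ∀ q x, IsUnit (b q x))
    (hB : ∀ m x, 0 ≤ B m x x)
    (hS : ∀ m x, B m (Matrix.toEuclideanLin (A m) x) x + B m x (Matrix.toEuclideanLin (A m) x) ≤
      -lam * B m x x)
    (hL : 0 ≤ L) (hlam : L / τd + c ≤ lam) (hT : 0 < T) (hk : 1 ≤ k)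
    {E : Set (ℝ × ℕ)} {z : ℝ → ℕ → FullState}
    (hz : IsHybridSolution (closedLoopSystem d b A τd N₀ T k) E z) {i : ℕ} {s t : ℝ} (hst : s ≤ t)
    (hI : Icc s t ⊆ flowInterval E i) {m : Fin Q} (hm : InMode n Q N₀ m (z s i)) :
    InMode n Q N₀ m (z t i) ∧
      muProj n (z t i) ^ (-(1 / k)) - muProj n (z s i) ^ (-(1 / k)) = -(1 / T) * (t - s) ∧
      energy L c T k (B m) (z t i) ≤ energy L c T k (B m) (z s i) := by
  -- If `s = t`, the flow interval may have empty interior, and then the flow condition says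
  -- nothing.
  rcases hst.eq_or_lt with rfl | hlt
  · exact ⟨hm, by simp, le_rfl⟩
  have hac := hz.absCont i s t hst hI
  have hacL : ∀ {F : Type} [NormedAddCommGroup F] [NormedSpace ℝ F] (φ : FullState →L[ℝ] F),
      AbsolutelyContinuousOnInterval (fun r => φ (z r i)) s t := fun φ =>
    (φ.lipschitz.lipschitzOnWith (s := univ)).comp_absolutelyContinuousOnInterval hac
      (mapsTo_univ _ _)
  have hint : (interior (flowInterval E i)).Nonempty := by
    rw [← nonempty_Ioo] at hlt
    exact hlt.mono (interior_maximal (Ioo_subset_Icc_self.trans hI) isOpen_Ioo)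
  have hflow : ∀ᵐ r ∂volume, r ∈ Ioo s t → z r i ∈ (closedLoopSystem d b A τd N₀ T k).C ∧
      ∃ v ∈ (closedLoopSystem d b A τd N₀ T k).F (z r i), HasDerivAt (fun u => z u i) v r := by
    filter_upwards [hz.flow i hint] with r hr hmem
    obtain ⟨h1, v, hv, hd⟩ := hr (hI (Ioo_subset_Icc_self hmem))
    exact ⟨h1, v, hv, hd.hasDerivAt (mem_of_superset (isOpen_Ioo.mem_nhds hmem)
      (Ioo_subset_Icc_self.trans hI))⟩
  have hcont : ∀ φ : FullState →L[ℝ] ℝ, ContinuousOn (fun r => φ (z r i)) (Icc s t) := fun φ => by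
    simpa [uIcc_of_le hst] using (hacL φ).continuousOn
  have hτ : MapsTo (fun r => tauProj n (z r i)) (Icc s t) (Icc 0 N₀) := by
    refine (hcont _).mapsTo_Icc_of_ae_mem_Ioo hlt isClosed_Icc ?_
    filter_upwards [hflow] with r hr hmem
    exact (hr hmem).1.1.1
  have hμ : MapsTo (fun r => muProj n (z r i)) (Icc s t) (Ici 1) := by
    refine (hcont _).mapsTo_Icc_of_ae_mem_Ioo hlt isClosed_Ici ?_
    filter_upwards [hflow] with r hr hmem
    exact (hr hmem).1.2
  -- The mode has zero derivative almost everywhere, so absolute continuity makes it constant and a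
  -- single form `B m` serves the whole interval.
  have hq : ∀ r ∈ Icc s t, qProj n (z r i) = m + 1 := by
    intro r hr
    have hsub : Icc s r ⊆ Icc s t := Icc_subset_Icc_right hr.2
    have := ((hacL (qProj n)).mono (c := s) (d := r)
      (by rwa [uIcc_of_le hst, uIcc_of_le hr.1])).sub_eq_of_ae_hasDerivAt (c := 0) hr.1 (by
        filter_upwards [hflow] with u hu hmem
        obtain ⟨-, v, hv, hd⟩ := hu ⟨hmem.1, hmem.2.trans_le hr.2⟩
        rw [← qProj_eq_zero_of_mem_F hv]
        exact (qProj n).hasFDerivAt.comp_hasDerivAt u hd)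
    rw [zero_mul, sub_eq_zero] at this
    rw [this, hm.2.1]
  have hd : ∀ᵐ r ∂volume, r ∈ Ioo s t →
      HasDerivAt (fun r => muProj n (z r i)) (k / T * muProj n (z r i) ^ (1 + 1 / k)) r ∧
      HasDerivAt (fun r => xProj n (z r i))
        (muProj n (z r i) • Matrix.toEuclideanLin (A m) (xProj n (z r i))) r ∧
      ∃ v ≤ muProj n (z r i) * (1 / τd), HasDerivAt (fun r => tauProj n (z r i)) v r := by
    filter_upwards [hflow] with r hr hmem
    obtain ⟨hC, v, hv, hd⟩ := hr hmem
    obtain ⟨e1, e2, e3⟩ := mem_closedLoopSystem_F hb hC.2 hv (hq r (Ioo_subset_Icc_self hmem))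
    have d1 : HasDerivAt (fun r => xProj n (z r i)) (xProj n v) r :=
      (xProj n).hasFDerivAt.comp_hasDerivAt r hd
    have d2 : HasDerivAt (fun r => muProj n (z r i)) (muProj n v) r :=
      (muProj n).hasFDerivAt.comp_hasDerivAt r hd
    have d3 : HasDerivAt (fun r => tauProj n (z r i)) (tauProj n v) r :=
      (tauProj n).hasFDerivAt.comp_hasDerivAt r hd
    rw [e1] at d1
    rw [e3] at d2
    exact ⟨d2, d1, tauProj n v, e2, d3⟩
  have ht : t ∈ Icc s t := right_mem_Icc.2 hst
  refine ⟨⟨hτ ht, hq t ht, hμ ht⟩, ?_, ?_⟩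
  · exact blowUp_flow_rpow hT hk hst (hacL (muProj n)) hμ (hd.mono fun r h hr => (h hr).1)
  · exact lyapunov_flow_le (B := B m) (S := fun y => Matrix.toEuclideanLin (A m) y)
      (x := fun r => xProj n (z r i)) (τ := fun r => tauProj n (z r i))
      (μ := fun r => muProj n (z r i)) (hB m) (hS m) hL hlam hT hk hst (hacL (xProj n))
      (hacL (tauProj n)) (hacL (muProj n)) hμ hd

theorem energy_jump_le (hB : ∀ m x, ‖x‖ ^ 2 ≤ B m x x) (hC : ∀ m x, B m x x ≤ C * ‖x‖ ^ 2)
    (hC0 : 0 ≤ C) (hCL : C * Real.exp (-L) ≤ Real.exp (-1))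
    {z w : FullState} (hw : w ∈ (closedLoopSystem d b A τd N₀ T k).G z)
    (hz : z ∈ (closedLoopSystem d b A τd N₀ T k).D) (m : Fin Q) :
    ∃ m', InMode n Q N₀ m' w ∧ muProj n w = muProj n z ∧
      energy L c T k (B m') w ≤ Real.exp (-1) * energy L c T k (B m) z := by
  obtain ⟨⟨hx, hτ, ⟨m', hm'⟩, -⟩, hμ⟩ := hw
  obtain ⟨⟨hτz, -⟩, hμz⟩ := hz
  replace hx : xProj n w = xProj n z := hx
  replace hτ : tauProj n w = tauProj n z - 1 := hτ
  replace hμ : muProj n w = muProj n z := hμ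
  replace hτz : tauProj n z ∈ Icc 1 N₀ := hτz
  refine ⟨m', ⟨?_, hm', ?_⟩, hμ, ?_⟩
  · rw [hτ]
    exact ⟨by linarith [hτz.1], by linarith [hτz.2]⟩
  · rw [hμ]
    exact hμz
  · have h1 : B m' (xProj n z) (xProj n z) ≤ C * B m (xProj n z) (xProj n z) :=
      (hC _ _).trans (mul_le_mul_of_nonneg_left (hB _ _) hC0)
    have h0 : 0 ≤ B m (xProj n z) (xProj n z) := (sq_nonneg _).trans (hB _ _)
    unfold energy
    rw [hx, hτ, hμ, show L * (tauProj n z - 1) = L * tauProj n z + -L by ring, Real.exp_add,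
      ← mul_assoc]
    refine mul_le_mul_of_nonneg_right ?_ (Real.exp_nonneg _)
    set e := Real.exp (L * tauProj n z)
    calc e * Real.exp (-L) * B m' (xProj n z) (xProj n z)
        ≤ e * Real.exp (-L) * (C * B m (xProj n z) (xProj n z)) := by gcongr
      _ = (C * Real.exp (-L)) * (e * B m (xProj n z) (xProj n z)) := by ring
      _ ≤ Real.exp (-1) * (e * B m (xProj n z) (xProj n z)) := by gcongr

theorem IsHybridSolution.energy_le (hb : ∀ q x, IsUnit (b q x))
    (hB : ∀ m x, ‖x‖ ^ 2 ≤ B m x x) (hC : ∀ m x, B m x x ≤ C * ‖x‖ ^ 2)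
    (hC0 : 0 ≤ C) (hCL : C * Real.exp (-L) ≤ Real.exp (-1))
    (hS : ∀ m x, B m (Matrix.toEuclideanLin (A m) x) x + B m x (Matrix.toEuclideanLin (A m) x) ≤
      -lam * B m x x)
    (hL : 0 ≤ L) (hlam : L / τd + c ≤ lam) (hT : 0 < T) (hk : 1 ≤ k)
    {E : Set (ℝ × ℕ)} {z : ℝ → ℕ → FullState}
    (hz : IsHybridSolution (closedLoopSystem d b A τd N₀ T k) E z)
    {m₀ : Fin Q} (hm₀ : InMode n Q N₀ m₀ (z 0 0)) {t : ℝ} {j : ℕ} (htj : (t, j) ∈ E) :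
    ∃ m, InMode n Q N₀ m (z t j) ∧
      muProj n (z t j) ^ (-(1 / k)) - muProj n (z 0 0) ^ (-(1 / k)) = -(1 / T) * t ∧
      energy L c T k (B m) (z t j) ≤ Real.exp (-j) * energy L c T k (B m₀) (z 0 0) := by
  obtain ⟨s, hs0, hst, hmono, hI⟩ := hz.domain.exists_partition htj
  have hB0 : ∀ m x, 0 ≤ B m x x := fun m x => (sq_nonneg _).trans (hB m x)
  -- The induction is on the number of jumps, with estimates at the end of each flow interval. Jumps
  -- preserve `μ`, so its linear relation accumulates over the flows.
  suffices H : ∀ i ≤ j, ∃ m, InMode n Q N₀ m (z (s (i + 1)) i) ∧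
      muProj n (z (s (i + 1)) i) ^ (-(1 / k)) - muProj n (z 0 0) ^ (-(1 / k)) =
        -(1 / T) * s (i + 1) ∧
      energy L c T k (B m) (z (s (i + 1)) i) ≤
        Real.exp (-i) * energy L c T k (B m₀) (z 0 0) by
    simpa only [hst] using H j le_rfl
  intro i
  induction i with
  | zero =>
    intro hi
    have h := hz.flow_step hb hB0 hS hL hlam hT hk (hmono 0 hi) (hI 0 hi) (m := m₀) (by rwa [hs0])
    rw [hs0, sub_zero] at h
    exact ⟨m₀, by simpa using h⟩
  | succ i ih =>
    intro hi
    obtain ⟨m, -, h2, h3⟩ := ih (by lia)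
    have hE1 : (s (i + 1), i) ∈ E := hI i (by lia) (right_mem_Icc.2 (hmono i (by lia)))
    have hE2 : (s (i + 1), i + 1) ∈ E := hI (i + 1) hi (left_mem_Icc.2 (hmono (i + 1) hi))
    obtain ⟨hD, hG⟩ := hz.jump _ _ hE1 hE2
    obtain ⟨m', h1', h2', h3'⟩ := energy_jump_le (c := c) hB hC hC0 hCL hG hD m
    obtain ⟨f1, f2, f3⟩ := hz.flow_step hb hB0 hS hL hlam hT hk (hmono _ hi) (hI _ hi) h1'
    refine ⟨m', f1, ?_, ?_⟩
    · rw [h2'] at f2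
      linear_combination f2 + h2
    · refine f3.trans (h3'.trans ?_)
      rw [show (-((i + 1 : ℕ) : ℝ)) = -1 + -(i : ℝ) by push_cast; ring, Real.exp_add, mul_assoc]
      exact mul_le_mul_of_nonneg_left h3 (Real.exp_nonneg _)

end Steps

/-! ### Comparison function, uniform constants and conclusion -/

theorem isKLL_mul_exp {K p r : ℝ} (hK : 0 ≤ K) (hp : 0 < p) (hr : 0 < r) :
    IsKLL fun x s j => K * x * Real.exp (-p * s - r * j) := by
  -- Freezing either time argument turns its exponential into the constant `D`.
  have aux : ∀ D q : ℝ, 0 ≤ D → 0 < q → IsKL fun x l => K * x * (D * Real.exp (-q * l)) := by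
    intro D q hD hq
    refine ⟨fun x l hx _ => by positivity, fun l _ x _ y _ hxy => ?_, fun x hx l _ l' _ hl => ?_,
      fun l _ => ?_, fun x _ => ?_⟩
    · dsimp only
      gcongr
    · have : -q * l' ≤ -q * l := by nlinarith
      dsimp only
      gcongr
    · have : Tendsto (fun x : ℝ => K * x * (D * Real.exp (-q * l))) (𝓝 0) (𝓝 (K * 0 * (D * Real.exp (-q * l)))) :=
        Continuous.tendsto (by fun_prop) 0
      simp only [mul_zero, zero_mul] at this
      exact this.mono_left nhdsWithin_le_nhds
    · have h : Tendsto (fun l : ℝ => Real.exp (-q * l)) atTop (𝓝 0) :=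
        Real.tendsto_exp_atBot.comp (tendsto_id.const_mul_atTop_of_neg (neg_lt_zero.2 hq))
      simpa using (h.const_mul D).const_mul (K * x)
  intro s _
  constructor
  · convert aux (Real.exp (-p * s)) r (Real.exp_nonneg _) hr using 4
    rw [← Real.exp_add]
    ring_nf
  · convert aux (Real.exp (-r * s)) p (Real.exp_nonneg _) hp using 4
    rw [← Real.exp_add]
    ring_nf

theorem exists_uniform_lyapunov_forms (hA : ∀ q, IsHurwitz (A q)) :
    ∃ (B : Fin Q → EuclideanSpace ℝ (Fin n) →L[ℝ] EuclideanSpace ℝ (Fin n) →L[ℝ] ℝ) (C lam : ℝ),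
      1 ≤ C ∧ 0 < lam ∧ (∀ m x, ‖x‖ ^ 2 ≤ B m x x) ∧ (∀ m x, B m x x ≤ C * ‖x‖ ^ 2) ∧
      ∀ m x, B m (Matrix.toEuclideanLin (A m) x) x + B m x (Matrix.toEuclideanLin (A m) x) ≤
        -lam * B m x x := by
  choose B c hc hB using fun q => (hA q).exists_lyapunov_form
  obtain ⟨C, hC⟩ := (Set.finite_range fun m => ‖B m‖).bddAbove
  obtain ⟨e, he, hec⟩ : ∃ e > 0, ∀ m, e ≤ c m := by
    rcases isEmpty_or_nonempty (Fin Q) with h | h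
    · exact ⟨1, one_pos, fun m => h.elim m⟩
    · obtain ⟨m, hm⟩ := Finite.exists_min c
      exact ⟨c m, hc m, hm⟩
  have hC1 : 0 < max C 1 := lt_max_of_lt_right one_pos
  have hBC : ∀ m x, B m x x ≤ max C 1 * ‖x‖ ^ 2 := fun m x => by
    have h1 : ‖B m‖ ≤ max C 1 := (hC ⟨m, rfl⟩).trans (le_max_left _ _)
    calc B m x x ≤ ‖B m x x‖ := le_abs_self _
      _ ≤ ‖B m‖ * ‖x‖ * ‖x‖ := (B m).le_opNorm₂ x x
      _ = ‖B m‖ * ‖x‖ ^ 2 := by ring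
      _ ≤ _ := by gcongr
  -- The upper bound on the forms converts decay `e‖x‖²` into decay at rate `e / max C 1` of the
  -- form itself.
  refine ⟨B, max C 1, e / max C 1, le_max_right _ _, by positivity, fun m x => (hB m x).1, hBC,
    fun m x => (hB m x).2.trans ?_⟩
  have h1 : e / max C 1 * B m x x ≤ e * ‖x‖ ^ 2 := by
    rw [div_mul_eq_mul_div, div_le_iff₀ hC1]
    nlinarith [mul_le_mul_of_nonneg_left (hBC m x) he.le]
  have h2 : e * ‖x‖ ^ 2 ≤ c m * ‖x‖ ^ 2 := mul_le_mul_of_nonneg_right (hec m) (sq_nonneg _)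
  linarith

end ClosedLoop

theorem proposition3 (n Q : ℕ) (hQ : 1 ≤ Q)
    (d : Fin Q → EuclideanSpace ℝ (Fin n) → EuclideanSpace ℝ (Fin n))
    (b : Fin Q → EuclideanSpace ℝ (Fin n) → Matrix (Fin n) (Fin n) ℝ)
    (A : Fin Q → Matrix (Fin n) (Fin n) ℝ)
    (hb : ∀ q x, IsUnit (b q x))
    (hA : ∀ q, IsHurwitz (A q)) :
    ∃ τd : ℝ, 0 < τd ∧ ∀ N₀ T k : ℝ, 1 ≤ N₀ → 0 < T → 1 ≤ k →
      IsPrescribedTimeStableViaFlows T k (closedLoopSystem d b A τd N₀ T k)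
        (targetSet n Q N₀) := by
  obtain ⟨B, C, lam, hC1, hlam, hB, hBC, hS⟩ := exists_uniform_lyapunov_forms hA
  have hC0 : 0 < C := zero_lt_one.trans_le hC1
  -- Chosen so that `C e^{-L} = e^{-1}`.
  set L := Real.log C + 1 with hLdef
  have hL : 0 < L := by have := Real.log_nonneg hC1; positivity
  have hCL : C * Real.exp (-L) ≤ Real.exp (-1) := by
    rw [hLdef, neg_add, Real.exp_add, Real.exp_neg (Real.log C), Real.exp_log hC0, ← mul_assoc,
      mul_inv_cancel₀ hC0.ne', one_mul]
  -- This `τd` spends half of the decay rate `lam` on the growth of `e^{Lτ}` and leaves `c = lam/2`.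
  -- The energy is quadratic in `x`, so taking square roots halves the rates to `lam/4` and `1/2`.
  refine ⟨2 * L / lam, by positivity, fun N₀ T k hN₀ hT hk => ⟨isCompact_targetSet n Q N₀,
    fun r s j => Real.sqrt (C * Real.exp (L * N₀)) * r * Real.exp (-(lam / 4) * s - 1 / 2 * j),
    isKLL_mul_exp (Real.sqrt_nonneg _) (by positivity) (by positivity), fun E z hz t j htj => ?_⟩⟩
  have hlam' : L / (2 * L / lam) + lam / 2 ≤ lam := by
    have : L / (2 * L / lam) = lam / 2 := by field_simp
    linarith
  obtain ⟨m₀, hm₀⟩ : ∃ m₀, InMode n Q N₀ m₀ (z 0 0) := by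
    rcases hz.initial with ⟨⟨hτ, m, hm⟩, hμ⟩ | ⟨⟨hτ, m, hm⟩, hμ⟩
    · exact ⟨m, hτ, hm, hμ⟩
    · exact ⟨m, ⟨zero_le_one.trans hτ.1, hτ.2⟩, hm, hμ⟩
  obtain ⟨m, hm, hμ, he⟩ := hz.energy_le hb hB hBC hC0.le hCL hS hL.le hlam' hT hk hm₀ htj
  rw [infDist_target hm.mem_switchSet hm.2.2, infDist_target hm₀.mem_switchSet hm₀.2.2]
  have hμ0 : 0 < muProj n (z 0 0) := zero_lt_one.trans_le hm₀.2.2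
  have hμt : 0 < muProj n (z t j) := zero_lt_one.trans_le hm.2.2
  have hD : timeDilation T k (muPart (z 0 0)) t = omegaFun T k (muProj n (z t j)) 1 -
    omegaFun T k (muProj n (z 0 0)) 1 := timeDilation_eq hT (by positivity) hμ0 hμt hμ
  rw [hD]
  set ω₁ := omegaFun T k (muProj n (z t j)) 1
  set ω₀ := omegaFun T k (muProj n (z 0 0)) 1
  set X := xProj n (z t j)
  set X₀ := xProj n (z 0 0)
  have h1 : ‖X‖ ^ 2 * Real.exp (lam / 2 * ω₁) ≤ energy L (lam / 2) T k (B m) (z t j) := by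
    refine mul_le_mul_of_nonneg_right ?_ (Real.exp_nonneg _)
    have : 1 ≤ Real.exp (L * tauProj n (z t j)) := Real.one_le_exp (mul_nonneg hL.le hm.1.1)
    nlinarith [hB m X, sq_nonneg ‖X‖]
  have h2 : energy L (lam / 2) T k (B m₀) (z 0 0) ≤
      Real.exp (L * N₀) * (C * ‖X₀‖ ^ 2) * Real.exp (lam / 2 * ω₀) := by
    refine mul_le_mul_of_nonneg_right ?_ (Real.exp_nonneg _)
    have := mul_le_mul_of_nonneg_left hm₀.1.2 hL.le
    exact mul_le_mul (Real.exp_le_exp.2 this) (hBC _ _) ((sq_nonneg _).trans (hB _ _))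
      (Real.exp_nonneg _)
  have h3 : ‖X‖ ^ 2 * Real.exp (lam / 2 * ω₁) ≤
      Real.exp (-j) * (Real.exp (L * N₀) * (C * ‖X₀‖ ^ 2) * Real.exp (lam / 2 * ω₀)) :=
    h1.trans (he.trans (mul_le_mul_of_nonneg_left h2 (Real.exp_nonneg _)))
  -- Both sides are squared and then multiplied by `e^{(lam/2)ω₁}`, which reduces the claim to `h3`.
  refine (sq_le_sq₀ (norm_nonneg _) (by positivity)).1 ?_
  have h4 : Real.exp (-(lam / 4) * (ω₁ - ω₀) - 1 / 2 * j) ^ 2 * Real.exp (lam / 2 * ω₁) =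
      Real.exp (-j) * Real.exp (lam / 2 * ω₀) := by
    rw [← Real.exp_nat_mul, ← Real.exp_add, ← Real.exp_add]
    congr 1
    push_cast
    ring
  rw [mul_pow, mul_pow, Real.sq_sqrt (by positivity)]
  refine le_of_mul_le_mul_right (h3.trans_eq ?_) (Real.exp_pos (lam / 2 * ω₁))
  rw [mul_assoc _ (_ ^ 2) (Real.exp _), h4]
  ring
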